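/- Let $\overline{\mathbb{Q}}$ be an algebraic closure of $\mathbb{Q}$. A polynomial $f\in\mathbb{Q}[z]$ is post-critically finite (PCF) if for every $\alpha\in\overline{\mathbb{Q}}$ with $f'(\alpha)=0$ the forward orbit $\{f^n(\alpha) : n\ge 0\}$ is finite, where $f^n$ is the $n$-th iterate of $f$. Two polynomials $f,g\in\mathbb{Q}[z]$ are called conjugate if $g=\varphi\circ f\circ\varphi^{-1}$ for some $\varphi(z)=az+b$ with $a,b\in\overline{\mathbb{Q}}$, $a\neq 0$. There are exactly fifteen conjugacy classes of cubic PCF polynomials defined over $\mathbb{Q}$. They are represented by the following polynomials: each of the fifteen is a cubic PCF polynomial, no two of them are conjugate, and every cubic PCF polynomial in $\mathbb{Q}[z]$ is conjugate to one of them. \begin{align*} (1)&\ z^3 & (2)&\ -z^3+1 & (3)&\ -2z^3+3z^2+\tfrac12\\ (4)&\ -2z^3+3z^2 & (5)&\ -z^3+\tfrac32z^2+1 & (6)&\ 2z^3-3z^2+1\\ (7)&\ 2z^3-3z^2+\tfrac12 & (8)&\ z^3-\tfrac32z^2 & (9)&\ -3z^3+\tfrac92z^2\\ (10)&\ -4z^3+6z^2-\tfrac12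 & (11)&\ 4z^3-6z^2+\tfrac32 & (12)&\ 3z^3-\tfrac92z^2+1\\ (13)&\ -z^3+\tfrac32z^2-1 & (14)&\ -\tfrac14z^3+\tfrac32z+2 & (15)&\ -\tfrac1{28}z^3-\tfrac34z+\tfrac72 \end{align*} -/

import Mathlib

open Polynomial

namespace CubicPCF

/-- The forward orbit `{f^n(α) | n ≥ 0}` of a point `α` under the polynomial `f`. -/
def orbit {L : Type*} [Field L] (f : L[X]) (α : L) : Set L :=
  {β | ∃ n : ℕ, β = (fun z => f.eval z)^[n] α}

/-- A polynomial `f` over a field `K` is post-critically finite if every critical point of `f`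
in the algebraic closure of `K` has a finite forward orbit. -/
def IsPCF {K : Type*} [Field K] (f : K[X]) : Prop :=
  ∀ α : AlgebraicClosure K,
    (derivative (f.map (algebraMap K (AlgebraicClosure K)))).eval α = 0 →
      (orbit (f.map (algebraMap K (AlgebraicClosure K))) α).Finite

/-- The conjugate `φ ∘ f ∘ φ⁻¹` of `f` by the affine map `φ(z) = a z + b`, where `a ≠ 0`, so that
`φ⁻¹(z) = a⁻¹ (z - b)`. -/
noncomputable def affineConj {L : Type*} [Field L] (a b : L) (f : L[X]) : L[X] :=
  (C a * X + C b).comp (f.comp (C a⁻¹ * (X - C b)))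

/-- Polynomials `f` and `g` over `K` are conjugate if `g = φ ∘ f ∘ φ⁻¹` for some invertible affine
map `φ` with coefficients in the algebraic closure of `K`. -/
def Conjugate {K : Type*} [Field K] (f g : K[X]) : Prop :=
  ∃ a b : AlgebraicClosure K, a ≠ 0 ∧
    g.map (algebraMap K (AlgebraicClosure K)) =
      affineConj a b (f.map (algebraMap K (AlgebraicClosure K)))

theorem affineConj_one_zero {L : Type*} [Field L] (f : L[X]) : affineConj 1 0 f = f := by
  simp [affineConj]

theorem affineConj_affineConj {L : Type*} [Field L] {a a' : L} (ha' : a' ≠ 0)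
    (b b' : L) (f : L[X]) :
    affineConj a' b' (affineConj a b f) = affineConj (a' * a) (a' * b + b') f := by
  have h : (C a⁻¹ * (X - C b)).comp (C a'⁻¹ * (X - C b')) =
      C (a' * a)⁻¹ * (X - C (a' * b + b')) := by
    have e : (C a'⁻¹ : L[X]) * C a' = 1 := by
      rw [← C_mul, inv_mul_cancel₀ ha', C_1]
    simp only [mul_comp, C_comp, sub_comp, X_comp, mul_inv, C_mul, C_add]
    linear_combination (C a⁻¹ * C b) * e
  simp only [affineConj, ← comp_assoc] at h ⊢
  rw [comp_assoc _ (C a⁻¹ * (X - C b)), h]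
  congr 2
  simp
  ring

theorem conjugate_equivalence (K : Type*) [Field K] :
    Equivalence (Conjugate : K[X] → K[X] → Prop) where
  refl f := ⟨1, 0, one_ne_zero, (affineConj_one_zero _).symm⟩
  symm := by
    rintro f g ⟨a, b, ha, h⟩
    refine ⟨a⁻¹, -(a⁻¹ * b), inv_ne_zero ha, ?_⟩
    rw [h, affineConj_affineConj (inv_ne_zero ha), inv_mul_cancel₀ ha, add_neg_cancel,
      affineConj_one_zero]
  trans := by
    rintro f g k ⟨a, b, ha, h⟩ ⟨a', b', ha', h'⟩
    exact ⟨a' * a, a' * b + b', mul_ne_zero ha' ha, by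
      rw [h', h, affineConj_affineConj ha']⟩

/-- Conjugacy over the algebraic closure, as an equivalence relation on `K[X]`. -/
def conjSetoid (K : Type*) [Field K] : Setoid K[X] :=
  ⟨Conjugate, conjugate_equivalence K⟩

/-- The set of conjugacy classes (over the algebraic closure of `ℚ`) of the cubic post-critically
finite polynomials defined over `ℚ`. -/
def cubicPCFClasses : Set (Quotient (conjSetoid ℚ)) :=
  {c | ∃ f : ℚ[X], f.natDegree = 3 ∧ IsPCF f ∧ c = Quotient.mk (conjSetoid ℚ) f}

/-- The fifteen representatives. -/
noncomputable def cubicPCFList : Fin 15 → ℚ[X] :=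
  ![X ^ 3,
    -X ^ 3 + 1,
    -2 * X ^ 3 + 3 * X ^ 2 + C (1 / 2),
    -2 * X ^ 3 + 3 * X ^ 2,
    -X ^ 3 + C (3 / 2) * X ^ 2 + 1,
    2 * X ^ 3 - 3 * X ^ 2 + 1,
    2 * X ^ 3 - 3 * X ^ 2 + C (1 / 2),
    X ^ 3 - C (3 / 2) * X ^ 2,
    -3 * X ^ 3 + C (9 / 2) * X ^ 2,
    -4 * X ^ 3 + 6 * X ^ 2 - C (1 / 2),
    4 * X ^ 3 - 6 * X ^ 2 + C (3 / 2),
    3 * X ^ 3 - C (9 / 2) * X ^ 2 + 1,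
    -X ^ 3 + C (3 / 2) * X ^ 2 - 1,
    -C (1 / 4) * X ^ 3 + C (3 / 2) * X + 2,
    -C (1 / 28) * X ^ 3 - C (3 / 4) * X + C (7 / 2)]

end CubicPCF

/-!
Every cubic over `ℚ` is conjugate over the algebraic closure to a monic centred one,
`F(z) = z³ - 3Gz + s`, with critical points `±γ` where `γ² = G`. The only remaining conjugacy is
`z ↦ -z`, which changes the sign of `s`, so the pair `(G, t)` with `t = s²` is a complete invariant;
it is a pair of rational numbers, given by `critSq` and `constSq` (`conjugate_toPoly_iff`).

The critical orbits are controlled by rational arithmetic alone: `Fⁿ(±γ) = ±xγ + ys`, where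
`(x, y) = critCoord G t n` is a pair of rational numbers (`iterate_centeredMap`). If these orbits are
finite, then no point of them may enter a region of `ℂ` or of an algebraic closure of `ℚ_p` on which
`F` strictly increases the absolute value. This yields two kinds of bounds.

* At every prime `p` both orbits stay in the disc of radius `max 1 |γ|`. Applied to the sum `2s` and
  the difference `4γ³` of the two critical values, this makes `4G` and `16t` integral. Applied to the
  product of the `n`-th points, it makes `den(G) (Gx² - ty²)` integral.
* Over `ℂ`, the parallelogram law gives `|G|x² + |t|y² ≤ 2 + 3|G|`. The case `n = 1` reads
  `4|G|³ + |t| ≤ 2 + 3|G|`, so that `|G| ≤ 1` and `|t| ≤ 5`.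

Hence `(G, t)` lies in a finite explicit set (`FiniteCritOrbits.exists_int`), and among its members
only fifteen satisfy both conditions for `n = 1, 2, 3` (`exists_listInvariants_eq_of_admissible`).
These are the invariants of the fifteen representatives, whose critical orbits are finite by
inspection (`isPCF_cubicPCFList`).
-/

namespace CubicPCF

/-! ### The two conjugacy invariants of a cubic -/

/-- The first conjugacy invariant of a cubic `P`. If `P` is conjugate to `z³ - 3Gz + s`, it is the
number `G`, the square of either critical point `±γ` of that monic centred form. -/
def critSq {K : Type*} [Field K] (P : Cubic K) : K :=
  P.b ^ 2 / (9 * P.a) - P.c / 3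

/-- The displacement `P(h) - h` of the centre `h = -b / (3a)` of the cubic `P`. -/
def centerShift {K : Type*} [Field K] (P : Cubic K) : K :=
  2 * P.b ^ 3 / (27 * P.a ^ 2) - P.b * P.c / (3 * P.a) + P.d + P.b / (3 * P.a)

/-- The second conjugacy invariant of a cubic `P`. If `P` is conjugate to `z³ - 3Gz + s`, it is
`s²`. -/
def constSq {K : Type*} [Field K] (P : Cubic K) : K :=
  P.a * centerShift P ^ 2

/-- The coefficients of the conjugate of a cubic by `z ↦ αz + β`. -/
def conjCubic {L : Type*} [Field L] (α β : L) (P : Cubic L) : Cubic L where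
  a := P.a / α ^ 2
  b := P.b / α - 3 * P.a * β / α ^ 2
  c := P.c - 2 * P.b * β / α + 3 * P.a * β ^ 2 / α ^ 2
  d := α * P.d + β - P.c * β + P.b * β ^ 2 / α - P.a * β ^ 3 / α ^ 2

theorem affineConj_toPoly {L : Type*} [Field L] [CharZero L] {α : L} (hα : α ≠ 0) (β : L)
    (P : Cubic L) : affineConj α β P.toPoly = (conjCubic α β P).toPoly := by
  refine Polynomial.funext fun z => ?_
  simp only [affineConj, Cubic.toPoly, conjCubic, eval_comp, eval_add, eval_mul, eval_C, eval_X,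
    eval_pow, eval_sub]
  field_simp
  ring

theorem critSq_conjCubic {L : Type*} [Field L] [CharZero L] {α : L} (hα : α ≠ 0) (β : L)
    {P : Cubic L} (hP : P.a ≠ 0) : critSq (conjCubic α β P) = critSq P := by
  simp only [critSq, conjCubic]
  field_simp
  ring

theorem centerShift_conjCubic {L : Type*} [Field L] [CharZero L] {α : L} (hα : α ≠ 0) (β : L)
    {P : Cubic L} (hP : P.a ≠ 0) : centerShift (conjCubic α β P) = α * centerShift P := by
  simp only [centerShift, conjCubic]
  field_simp
  ring

theorem constSq_conjCubic {L : Type*} [Field L] [CharZero L] {α : L} (hα : α ≠ 0) (β : L)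
    {P : Cubic L} (hP : P.a ≠ 0) : constSq (conjCubic α β P) = constSq P := by
  rw [constSq, centerShift_conjCubic hα β hP, constSq, conjCubic]
  field_simp

/-- Over an algebraically closed field every cubic is conjugate to a monic centred one, and either
square root of `constSq P` may be prescribed as its constant term. -/
theorem exists_affineConj_eq_centered {L : Type*} [Field L] [CharZero L] [IsAlgClosed L]
    {P : Cubic L} (hP : P.a ≠ 0) {s : L} (hs : s ^ 2 = constSq P) :
    ∃ α β : L, α ≠ 0 ∧ affineConj α β P.toPoly = (Cubic.mk 1 0 (-3 * critSq P) s).toPoly := by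
  obtain ⟨α, hα, hαs⟩ : ∃ α : L, α ^ 2 = P.a ∧ α * centerShift P = s := by
    by_cases hc : centerShift P = 0
    · obtain ⟨α, hα⟩ := IsAlgClosed.exists_pow_nat_eq P.a two_pos
      have : s = 0 := by simpa [constSq, hc] using hs
      exact ⟨α, hα, by rw [hc, this, mul_zero]⟩
    · refine ⟨s / centerShift P, ?_, div_mul_cancel₀ s hc⟩
      rw [div_pow, hs, constSq]
      field_simp
  have hα0 : α ≠ 0 := by
    rintro rfl
    exact hP (by rw [← hα]; simp)
  refine ⟨α, α * P.b / (3 * P.a), hα0, ?_⟩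
  rw [affineConj_toPoly hα0]
  congr 1
  obtain ⟨a, b, c, d⟩ := P
  simp only at hα
  subst hα
  rw [← hαs]
  simp only [conjCubic, critSq, centerShift, Cubic.mk.injEq]
  refine ⟨?_, ?_, ?_, ?_⟩ <;> field_simp <;> ring

theorem critSq_map {K L : Type*} [Field K] [Field L] (φ : K →+* L) (P : Cubic K) :
    critSq (P.map φ) = φ (critSq P) := by
  simp [critSq, Cubic.map, map_ofNat φ]

theorem constSq_map {K L : Type*} [Field K] [Field L] (φ : K →+* L) (P : Cubic K) :
    constSq (P.map φ) = φ (constSq P) := by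
  simp [constSq, centerShift, Cubic.map, map_ofNat φ]

theorem conjugate_toPoly_iff {K : Type*} [Field K] [CharZero K] {P Q : Cubic K} (hP : P.a ≠ 0)
    (hQ : Q.a ≠ 0) :
    Conjugate P.toPoly Q.toPoly ↔ critSq P = critSq Q ∧ constSq P = constSq Q := by
  have : CharZero (AlgebraicClosure K) := charZero_of_injective_algebraMap
    (algebraMap K (AlgebraicClosure K)).injective
  let φ := algebraMap K (AlgebraicClosure K)
  have hφ : Function.Injective φ := φ.injective
  have hP' : (P.map φ).a ≠ 0 := (map_ne_zero φ).2 hP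
  have hQ' : (Q.map φ).a ≠ 0 := (map_ne_zero φ).2 hQ
  constructor
  · rintro ⟨α, β, hα, h⟩
    rw [← Cubic.map_toPoly, ← Cubic.map_toPoly, affineConj_toPoly hα] at h
    have h' := (Cubic.toPoly_injective _ _).1 h
    constructor <;> apply hφ
    · rw [← critSq_map, ← critSq_map, h', critSq_conjCubic hα β hP']
    · rw [← constSq_map, ← constSq_map, h', constSq_conjCubic hα β hP']
  · rintro ⟨h1, h2⟩
    obtain ⟨s, hs⟩ := IsAlgClosed.exists_pow_nat_eq (φ (constSq P)) two_pos
    obtain ⟨α, β, hα, h⟩ := exists_affineConj_eq_centered hP' (s := s) (by rw [hs, constSq_map])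
    obtain ⟨α', β', hα', h'⟩ := exists_affineConj_eq_centered hQ' (s := s)
      (by rw [hs, constSq_map, h2])
    rw [critSq_map, ← h1, ← critSq_map, ← h] at h'
    -- Both cubics are carried to the same centred form, so the second map is undone after the first.
    refine ⟨α'⁻¹ * α, α'⁻¹ * β + -(α'⁻¹ * β'), mul_ne_zero (inv_ne_zero hα') hα, ?_⟩
    rw [← affineConj_affineConj (inv_ne_zero hα'), ← Cubic.map_toPoly, ← Cubic.map_toPoly, ← h',
      affineConj_affineConj (inv_ne_zero hα'), inv_mul_cancel₀ hα', add_neg_cancel,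
      affineConj_one_zero]

theorem exists_cubic_toPoly_eq {K : Type*} [Field K] {f : K[X]} (hf : f.natDegree = 3) :
    ∃ P : Cubic K, P.a ≠ 0 ∧ P.toPoly = f := by
  refine ⟨⟨f.coeff 3, f.coeff 2, f.coeff 1, f.coeff 0⟩, ?_, ?_⟩
  · have : f ≠ 0 := by rintro rfl; simp at hf
    simpa [leadingCoeff, hf] using leadingCoeff_ne_zero.2 this
  · conv_rhs => rw [f.as_sum_range_C_mul_X_pow, hf]
    simp only [Cubic.toPoly, Finset.sum_range_succ, Finset.sum_range_zero]
    ring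

/-! ### From post-critical finiteness to the orbits of the centred form -/

/-- The monic centred cubic map `z ↦ z³ - 3Gz + s`, with critical points the square roots of `G`. -/
def centeredMap {L : Type*} [Field L] (G s z : L) : L :=
  z ^ 3 - 3 * G * z + s

theorem eval_affineConj {L : Type*} [Field L] {α : L} (hα : α ≠ 0) (β : L) (f : L[X]) (z : L) :
    (affineConj α β f).eval (α * z + β) = α * f.eval z + β := by
  simp [affineConj, eval_comp, hα]

theorem eval_derivative_affineConj {L : Type*} [Field L] {α : L} (hα : α ≠ 0) (β : L) (f : L[X])
    (z : L) : (derivative (affineConj α β f)).eval (α * z + β) = (derivative f).eval z := by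
  simp [affineConj, derivative_comp, eval_comp, hα]

/-- The critical orbits of a post-critically finite cubic are carried by the conjugacy to those of the
monic centred form. -/
theorem IsPCF.exists_centeredMap {P : Cubic ℚ} (hP : P.a ≠ 0) (h : IsPCF P.toPoly) :
    ∃ γ s : AlgebraicClosure ℚ, γ ^ 2 = (critSq P : ℚ) ∧ s ^ 2 = (constSq P : ℚ) ∧
      ∀ w, w ^ 2 = γ ^ 2 →
        (Set.range fun n => (centeredMap (γ ^ 2) s)^[n] w).Finite := by
  let φ := algebraMap ℚ (AlgebraicClosure ℚ)
  obtain ⟨γ, hγ⟩ := IsAlgClosed.exists_pow_nat_eq (φ (critSq P)) two_pos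
  obtain ⟨s, hs⟩ := IsAlgClosed.exists_pow_nat_eq (φ (constSq P)) two_pos
  have hP' : (P.map φ).a ≠ 0 := (map_ne_zero φ).2 hP
  obtain ⟨α, β, hα, hc⟩ := exists_affineConj_eq_centered hP' (s := s) (by rw [hs, constSq_map])
  rw [critSq_map, ← hγ] at hc
  refine ⟨γ, s, hγ, hs, fun w hw => ?_⟩
  obtain ⟨z, rfl⟩ : ∃ z, w = α * z + β := ⟨α⁻¹ * (w - β), by field_simp; ring⟩
  have hz : (derivative (P.map φ).toPoly).eval z = 0 := by
    rw [← eval_derivative_affineConj hα β, hc]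
    simp only [Cubic.toPoly, derivative_add, derivative_mul, derivative_C, derivative_X_pow,
      derivative_X, eval_add, eval_mul, eval_pow, eval_C, eval_X, eval_zero, eval_one]
    push_cast
    linear_combination 3 * hw
  rw [Cubic.map_toPoly] at hz
  have hfin := (h z hz).image fun x => α * x + β
  refine hfin.subset ?_
  rintro _ ⟨n, rfl⟩
  refine ⟨_, ⟨n, rfl⟩, ?_⟩
  have hsemi : Function.Semiconj (fun x => α * x + β)
      (fun x => ((P.toPoly).map φ).eval x) (centeredMap (γ ^ 2) s) := fun x => by
    simp only [← Cubic.map_toPoly]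
    rw [← eval_affineConj hα, hc]
    simp [Cubic.toPoly, centeredMap]
    ring
  exact hsemi.iterate_right n z

/-! ### Escape to infinity -/

/-- A map that strictly increases the norm on a set which it preserves has no finite orbit entering
that set. -/
theorem iterate_notMem_of_finite_orbit {L : Type*} [NormedField L] {F : L → L} {T : Set L}
    (hT : ∀ z ∈ T, F z ∈ T) (hF : ∀ z ∈ T, ‖z‖ < ‖F z‖) {w : L}
    (hw : (Set.range fun n => F^[n] w).Finite) (n : ℕ) : F^[n] w ∉ T := by
  intro h
  have hmem : ∀ k, F^[k + n] w ∈ T := by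
    intro k
    induction k with
    | zero => simpa using h
    | succ k ih => rw [Nat.succ_add, Function.iterate_succ_apply']; exact hT _ ih
  have hmono : StrictMono fun k => ‖F^[k + n] w‖ := strictMono_nat_of_lt_succ fun k => by
    rw [Nat.succ_add, Function.iterate_succ_apply']
    exact hF _ (hmem k)
  have hinj : Function.Injective fun k => F^[k + n] w := fun i j hij =>
    hmono.injective (congrArg norm hij)
  exact Set.infinite_range_of_injective hinj (hw.subset (by rintro _ ⟨k, rfl⟩; exact ⟨k + n, rfl⟩))

/-- One step of the critical orbit in rational coordinates: if `γ² = G` and `s² = t`, then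
`z ↦ z³ - 3Gz + s` sends `xγ + ys` to `x'γ + y's`, where `(x', y')` is the step of `(x, y)`. -/
def coordStep (G t : ℚ) (w : ℚ × ℚ) : ℚ × ℚ :=
  (G * w.1 ^ 3 + 3 * t * w.1 * w.2 ^ 2 - 3 * G * w.1,
    3 * G * w.1 ^ 2 * w.2 + t * w.2 ^ 3 - 3 * G * w.2 + 1)

/-- The coordinates of the `n`-th point of the orbit of the critical point `γ = 1γ + 0s`. -/
def critCoord (G t : ℚ) (n : ℕ) : ℚ × ℚ :=
  (coordStep G t)^[n] (1, 0)

/-- The coordinates do not depend on the choice of the square root `γ`, so that they describe the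
orbits of `γ` and of `-γ` at once. -/
theorem iterate_centeredMap {L : Type*} [Field L] [CharZero L] {γ s : L} {G t : ℚ}
    (hγ : γ ^ 2 = G) (hs : s ^ 2 = t) (n : ℕ) :
    (centeredMap (γ ^ 2) s)^[n] γ = (critCoord G t n).1 * γ + (critCoord G t n).2 * s := by
  induction n with
  | zero => simp [critCoord]
  | succ n ih =>
    rw [Function.iterate_succ_apply', ih, critCoord, critCoord, Function.iterate_succ_apply']
    generalize (coordStep G t)^[n] (1, 0) = w
    simp only [coordStep, centeredMap]
    push_cast
    rw [← hγ, ← hs]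
    ring

/-- The field-independent form of post-critical finiteness of `z³ - 3Gz + s`: both critical orbits
are finite, in a field containing square roots `γ` of `G` and `s` of `t`. -/
structure FiniteCritOrbits {L : Type*} [Field L] (G t : ℚ) (γ s : L) : Prop where
  sq_crit : γ ^ 2 = G
  sq_const : s ^ 2 = t
  finite : ∀ w, w ^ 2 = γ ^ 2 → (Set.range fun n => (centeredMap (γ ^ 2) s)^[n] w).Finite

theorem FiniteCritOrbits.map {L L' : Type*} [Field L] [Field L'] [CharZero L'] {G t : ℚ} {γ s : L}
    (h : FiniteCritOrbits G t γ s) (φ : L →+* L') : FiniteCritOrbits G t (φ γ) (φ s) where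
  sq_crit := by rw [← map_pow, h.sq_crit, map_ratCast]
  sq_const := by rw [← map_pow, h.sq_const, map_ratCast]
  finite w hw := by
    obtain ⟨v, rfl, hv⟩ : ∃ v, φ v = w ∧ v ^ 2 = γ ^ 2 := by
      rcases sq_eq_sq_iff_eq_or_eq_neg.1 hw with rfl | rfl
      · exact ⟨γ, rfl, rfl⟩
      · exact ⟨-γ, map_neg φ γ, neg_sq γ⟩
    refine ((h.finite v hv).image φ).subset ?_
    rintro _ ⟨n, rfl⟩
    have hsemi : Function.Semiconj φ (centeredMap (γ ^ 2) s) (centeredMap (φ γ ^ 2) (φ s)) :=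
      fun x => by simp [centeredMap, map_ofNat φ]
    exact ⟨_, ⟨n, rfl⟩, hsemi.iterate_right n v⟩

/-! ### The archimedean bound -/

/-- On the region `|z|² > 2 + 3|G|`, `|z| ≥ |s|` the map strictly increases the absolute value, so a
critical orbit cannot enter it. -/
theorem FiniteCritOrbits.complex_norm_le {G t : ℚ} {γ s : ℂ} (h : FiniteCritOrbits G t γ s) {w : ℂ}
    (hw : w ^ 2 = γ ^ 2) (n : ℕ) (hn : ‖s‖ ≤ ‖(centeredMap (γ ^ 2) s)^[n] w‖) :
    ‖(centeredMap (γ ^ 2) s)^[n] w‖ ^ 2 ≤ 2 + 3 * ‖γ‖ ^ 2 := by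
  have hgrow : ∀ z ∈ {z : ℂ | 2 + 3 * ‖γ‖ ^ 2 < ‖z‖ ^ 2 ∧ ‖s‖ ≤ ‖z‖},
      ‖z‖ < ‖centeredMap (γ ^ 2) s z‖ := by
    rintro z ⟨h1, h2⟩
    have hz : 0 < ‖z‖ := by
      by_contra! h0
      have : ‖z‖ = 0 := le_antisymm h0 (norm_nonneg z)
      rw [this] at h1
      nlinarith [sq_nonneg ‖γ‖]
    have htri : ‖z‖ ^ 3 ≤ ‖centeredMap (γ ^ 2) s z‖ + 3 * ‖γ‖ ^ 2 * ‖z‖ + ‖s‖ := by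
      calc ‖z‖ ^ 3 = ‖centeredMap (γ ^ 2) s z + 3 * γ ^ 2 * z - s‖ := by
            rw [← norm_pow]; congr 1; simp only [centeredMap]; ring
        _ ≤ ‖centeredMap (γ ^ 2) s z + 3 * γ ^ 2 * z‖ + ‖s‖ := norm_sub_le _ _
        _ ≤ ‖centeredMap (γ ^ 2) s z‖ + ‖3 * γ ^ 2 * z‖ + ‖s‖ := by gcongr; exact norm_add_le _ _
        _ = _ := by simp
    nlinarith [mul_lt_mul_of_pos_right h1 hz]
  by_contra! hlt
  refine iterate_notMem_of_finite_orbit (fun z hz => ?_) hgrow (h.finite w hw) n ⟨hlt, hn⟩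
  have := hgrow z hz
  exact ⟨hz.1.trans (by gcongr), hz.2.trans this.le⟩

/-- The parallelogram law bounds the coordinates of the critical orbits by the sizes of the two
points `±xγ + ys`. -/
theorem FiniteCritOrbits.height_le {G t : ℚ} {γ s : ℂ} (h : FiniteCritOrbits G t γ s) (n : ℕ)
    (ht : |t| ≤ |G| * (critCoord G t n).1 ^ 2 + |t| * (critCoord G t n).2 ^ 2) :
    |G| * (critCoord G t n).1 ^ 2 + |t| * (critCoord G t n).2 ^ 2 ≤ 2 + 3 * |G| := by
  have hG : ‖γ‖ ^ 2 = (|G| : ℚ) := by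
    rw [← norm_pow, h.sq_crit, ← Complex.ofReal_ratCast, Complex.norm_real, Real.norm_eq_abs]
    push_cast; rfl
  have hs : ‖s‖ ^ 2 = (|t| : ℚ) := by
    rw [← norm_pow, h.sq_const, ← Complex.ofReal_ratCast, Complex.norm_real, Real.norm_eq_abs]
    push_cast; rfl
  have e1 := iterate_centeredMap h.sq_crit h.sq_const n
  have e2 := iterate_centeredMap (γ := -γ) (by rw [neg_sq, h.sq_crit]) h.sq_const n
  rw [neg_sq] at e2
  have b1 := h.complex_norm_le rfl n
  have b2 := h.complex_norm_le (neg_sq γ) n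
  rw [e1] at b1
  rw [e2] at b2
  generalize critCoord G t n = w at *
  obtain ⟨x, y⟩ := w
  simp only at *
  have hpar := parallelogram_law_with_norm ℝ (y * s : ℂ) (x * γ)
  have hx : ‖(x * γ : ℂ)‖ ^ 2 = (|G| * x ^ 2 : ℚ) := by
    rw [norm_mul, mul_pow, hG, ← Complex.ofReal_ratCast, Complex.norm_real, Real.norm_eq_abs, sq_abs]
    push_cast; ring
  have hy : ‖(y * s : ℂ)‖ ^ 2 = (|t| * y ^ 2 : ℚ) := by
    rw [norm_mul, mul_pow, hs, ← Complex.ofReal_ratCast, Complex.norm_real, Real.norm_eq_abs, sq_abs]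
    push_cast; ring
  rw [show (y * s + x * γ : ℂ) = x * γ + y * s by ring,
    show (y * s - x * γ : ℂ) = x * -γ + y * s by ring] at hpar
  have hsum : ((|G| * x ^ 2 + |t| * y ^ 2 : ℚ) : ℝ) = ‖(x * γ : ℂ)‖ ^ 2 + ‖(y * s : ℂ)‖ ^ 2 := by
    rw [hx, hy]; push_cast; rfl
  have key : ((|G| * x ^ 2 + |t| * y ^ 2 : ℚ) : ℝ) ≤ (2 + 3 * |G| : ℚ) := by
    have hle : ‖s‖ ^ 2 ≤ ((|G| * x ^ 2 + |t| * y ^ 2 : ℚ) : ℝ) := by rw [hs]; exact_mod_cast ht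
    have hG' : ((2 + 3 * |G| : ℚ) : ℝ) = 2 + 3 * ‖γ‖ ^ 2 := by rw [hG]; push_cast; rfl
    rw [hG']
    -- The larger of the two points `±xγ + ys` has squared norm at least the mean of both.
    rcases le_total ‖(x * γ + y * s : ℂ)‖ ‖(x * -γ + y * s : ℂ)‖ with hc | hc
    · have := mul_self_le_mul_self (norm_nonneg _) hc
      have := b2 (abs_le_of_sq_le_sq' (by nlinarith) (norm_nonneg _)).2
      nlinarith
    · have := mul_self_le_mul_self (norm_nonneg _) hc
      have := b1 (abs_le_of_sq_le_sq' (by nlinarith) (norm_nonneg _)).2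
      nlinarith
  exact_mod_cast key

/-! ### The nonarchimedean bounds -/

section Ultrametric

variable {L : Type*} [NormedField L] [IsUltrametricDist L]

theorem norm_ofNat_le_one (n : ℕ) [n.AtLeastTwo] : ‖(OfNat.ofNat n : L)‖ ≤ 1 := by
  rw [← Nat.cast_ofNat]
  exact IsUltrametricDist.norm_natCast_le_one L _

theorem norm_centeredMap_of_lt {γ s z : L} (h1 : ‖γ‖ < ‖z‖) (h2 : ‖s‖ < ‖z‖ ^ 3) :
    ‖centeredMap (γ ^ 2) s z‖ = ‖z‖ ^ 3 := by
  have hz : 0 < ‖z‖ := (norm_nonneg γ).trans_lt h1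
  have hlin : ‖-(3 * γ ^ 2 * z)‖ < ‖z‖ ^ 3 := by
    rw [norm_neg, norm_mul, norm_mul, norm_pow]
    calc ‖(3 : L)‖ * ‖γ‖ ^ 2 * ‖z‖ ≤ 1 * ‖γ‖ ^ 2 * ‖z‖ := by gcongr; exact norm_ofNat_le_one 3
      _ < ‖z‖ ^ 3 := by nlinarith [pow_lt_pow_left₀ h1 (norm_nonneg γ) two_ne_zero]
  have hrest : ‖-(3 * γ ^ 2 * z) + s‖ < ‖z ^ 3‖ := by
    rw [norm_pow]
    exact (IsUltrametricDist.norm_add_le_max _ _).trans_lt (max_lt hlin h2)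
  rw [show centeredMap (γ ^ 2) s z = z ^ 3 + (-(3 * γ ^ 2 * z) + s) by simp [centeredMap]; ring,
    IsUltrametricDist.norm_add_eq_max_of_norm_ne_norm hrest.ne', max_eq_left hrest.le, norm_pow]

/-- Outside the unit disc and the disc through `γ`, the term `z³` dominates the linear term, so an orbit
point there escapes unless `s` is at least as large as `z³`. -/
theorem FiniteCritOrbits.norm_cube_le_norm_const {G t : ℚ} {γ s : L}
    (h : FiniteCritOrbits G t γ s) {w : L} (hw : w ^ 2 = γ ^ 2) (n : ℕ) {z : L}
    (hz : (centeredMap (γ ^ 2) s)^[n] w = z)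
    (h1 : 1 < ‖z‖) (h2 : ‖γ‖ < ‖z‖) : ‖z‖ ^ 3 ≤ ‖s‖ := by
  by_contra! h3
  have hgrow : ∀ z ∈ {z : L | 1 < ‖z‖ ∧ ‖γ‖ < ‖z‖ ∧ ‖s‖ < ‖z‖ ^ 3},
      ‖z‖ < ‖centeredMap (γ ^ 2) s z‖ := by
    rintro z ⟨h1, h2, h3⟩
    rw [norm_centeredMap_of_lt h2 h3]
    exact lt_self_pow₀ h1 (by norm_num)
  refine iterate_notMem_of_finite_orbit (fun z hz => ?_) hgrow (h.finite w hw) n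
    (hz ▸ ⟨h1, h2, h3⟩)
  have := hgrow z hz
  exact ⟨hz.1.trans this, hz.2.1.trans this, hz.2.2.trans (by gcongr)⟩

/-- If `s` were large, the critical value `s - 2γ³` would be as large as `s`, and would escape. -/
theorem FiniteCritOrbits.norm_const_le {G t : ℚ} {γ s : L} (h : FiniteCritOrbits G t γ s) :
    ‖s‖ ≤ max 1 ‖γ‖ ^ 3 := by
  by_contra! hs
  have hR : 1 ≤ max 1 ‖γ‖ := le_max_left _ _
  have hR3 : max 1 ‖γ‖ ≤ max 1 ‖γ‖ ^ 3 := le_self_pow₀ hR (by norm_num)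
  have hs1 : 1 < ‖s‖ := by linarith
  have hsγ : ‖γ‖ < ‖s‖ := by linarith [le_max_right 1 ‖γ‖]
  have hlt : ‖-(2 * γ ^ 3)‖ < ‖s‖ := by
    rw [norm_neg, norm_mul, norm_pow]
    calc ‖(2 : L)‖ * ‖γ‖ ^ 3 ≤ 1 * max 1 ‖γ‖ ^ 3 := by
          gcongr
          · exact norm_ofNat_le_one 2
          · exact le_max_right _ _
      _ < ‖s‖ := by linarith
  have hv : ‖-(2 * γ ^ 3) + s‖ = ‖s‖ := by
    rw [IsUltrametricDist.norm_add_eq_max_of_norm_ne_norm hlt.ne, max_eq_right hlt.le]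
  have := h.norm_cube_le_norm_const rfl 1 (z := -(2 * γ ^ 3) + s)
    (by simp [centeredMap]; ring) (by rwa [hv]) (by rwa [hv])
  rw [hv] at this
  exact this.not_gt (lt_self_pow₀ hs1 (by norm_num))

/-- Both critical orbits stay in the disc of radius `max 1 |γ|`. -/
theorem FiniteCritOrbits.norm_iterate_le {G t : ℚ} {γ s : L} (h : FiniteCritOrbits G t γ s) {w : L}
    (hw : w ^ 2 = γ ^ 2) (n : ℕ) : ‖(centeredMap (γ ^ 2) s)^[n] w‖ ≤ max 1 ‖γ‖ := by
  by_contra! hlt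
  have := h.norm_cube_le_norm_const hw n rfl ((le_max_left _ _).trans_lt hlt)
    ((le_max_right _ _).trans_lt hlt)
  have h3 := pow_lt_pow_left₀ hlt (by positivity) three_ne_zero
  linarith [h.norm_const_le]

/-- The difference `4γ³` of the two critical values is no larger than the orbits. -/
theorem FiniteCritOrbits.norm_four_mul_crit_le {G t : ℚ} {γ s : L} (h : FiniteCritOrbits G t γ s) :
    ‖4 * γ ^ 2‖ ≤ 1 := by
  have h4 : ‖(4 : L)‖ ≤ 1 := norm_ofNat_le_one 4
  have b : ‖4 * γ ^ 3‖ ≤ max 1 ‖γ‖ := by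
    rw [show 4 * γ ^ 3 = centeredMap (γ ^ 2) s (-γ) - centeredMap (γ ^ 2) s γ by
      simp [centeredMap]; ring, sub_eq_add_neg]
    refine (IsUltrametricDist.norm_add_le_max _ _).trans
      (max_le (h.norm_iterate_le (neg_sq γ) 1) ?_)
    rw [norm_neg]
    exact h.norm_iterate_le rfl 1
  rw [norm_mul, norm_pow] at b ⊢
  rcases le_or_gt ‖γ‖ 1 with h1 | h1
  · exact mul_le_one₀ h4 (by positivity) (pow_le_one₀ (norm_nonneg γ) h1)
  · rw [max_eq_right h1.le] at b
    by_contra! hc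
    nlinarith

/-- The sum `2s` of the two critical values is no larger than the orbits. -/
theorem FiniteCritOrbits.norm_sixteen_mul_const_le {G t : ℚ} {γ s : L}
    (h : FiniteCritOrbits G t γ s) : ‖16 * s ^ 2‖ ≤ 1 := by
  have b : ‖2 * s‖ ≤ max 1 ‖γ‖ := by
    rw [show 2 * s = centeredMap (γ ^ 2) s (-γ) + centeredMap (γ ^ 2) s γ by
      simp [centeredMap]; ring]
    exact (IsUltrametricDist.norm_add_le_max _ _).trans
      (max_le (h.norm_iterate_le (neg_sq γ) 1) (h.norm_iterate_le rfl 1))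
  have h4 : ‖(4 : L)‖ ≤ 1 := norm_ofNat_le_one 4
  have hγ := h.norm_four_mul_crit_le
  rw [norm_mul, norm_pow] at hγ
  calc ‖16 * s ^ 2‖ = ‖(4 : L)‖ * ‖2 * s‖ ^ 2 := by
        rw [← norm_pow, ← norm_mul]; congr 1; ring
    _ ≤ ‖(4 : L)‖ * max 1 ‖γ‖ ^ 2 := by gcongr
    _ ≤ 1 := by rcases max_cases 1 ‖γ‖ with ⟨e, _⟩ | ⟨e, _⟩ <;> rw [e] <;> simpa

/-- The product of the `n`-th points `±xγ + ys` of the two critical orbits, up to sign. The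
denominator of `G` compensates for the absolute value of `γ²` where this exceeds `1`. -/
theorem FiniteCritOrbits.norm_product_le [CharZero L] {G t : ℚ} {γ s : L}
    (h : FiniteCritOrbits G t γ s) (n : ℕ) :
    ‖((G.den * (G * (critCoord G t n).1 ^ 2 - t * (critCoord G t n).2 ^ 2) : ℚ) : L)‖ ≤ 1 := by
  have b1 := h.norm_iterate_le rfl n
  have b2 := h.norm_iterate_le (neg_sq γ) n
  rw [iterate_centeredMap h.sq_crit h.sq_const n] at b1
  rw [← neg_sq, iterate_centeredMap (by rw [neg_sq, h.sq_crit]) h.sq_const n] at b2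
  have hden : ‖(G.den : L)‖ ≤ 1 := IsUltrametricDist.norm_natCast_le_one L _
  have hnum : ‖(G.den : L)‖ * ‖γ‖ ^ 2 ≤ 1 := by
    have : (G.den : L) * γ ^ 2 = G.num := by
      rw [h.sq_crit, mul_comm]; exact_mod_cast congrArg (Rat.cast : ℚ → L) (Rat.mul_den_eq_num G)
    rw [← norm_pow, ← norm_mul, this]
    exact IsUltrametricDist.norm_intCast_le_one L _
  generalize critCoord G t n = w at *
  calc ‖((G.den * (G * w.1 ^ 2 - t * w.2 ^ 2) : ℚ) : L)‖
      = ‖(G.den : L) * -((w.1 * γ + w.2 * s) * (w.1 * -γ + w.2 * s))‖ := by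
        push_cast
        rw [← h.sq_crit, ← h.sq_const]
        congr 1
        ring
    _ = ‖(G.den : L)‖ * (‖w.1 * γ + w.2 * s‖ * ‖w.1 * -γ + w.2 * s‖) := by
        rw [norm_mul, norm_neg, norm_mul]
    _ ≤ ‖(G.den : L)‖ * (max 1 ‖γ‖ * max 1 ‖γ‖) := by gcongr
    _ ≤ 1 := by
        rcases max_cases 1 ‖γ‖ with ⟨e, _⟩ | ⟨e, _⟩ <;> rw [e]
        · simpa
        · rwa [← sq]

end Ultrametric

/-! ### Reduction to finitely many invariants -/

theorem rat_den_eq_one_of_forall_norm_le_one {q : ℚ}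
    (h : ∀ (p : ℕ) [Fact p.Prime], ‖(q : PadicAlgCl p)‖ ≤ 1) : q.den = 1 := by
  by_contra hq
  obtain ⟨p, hp, hpq⟩ := Nat.exists_prime_and_dvd hq
  have : Fact p.Prime := ⟨hp⟩
  have hnorm : ‖(q : ℚ_[p])‖ ≤ 1 := by
    rw [← PadicAlgCl.norm_extends]
    simpa using h p
  rw [Padic.norm_rat_le_one_iff_padicValuation_le_one, Rat.padicValuation_le_one_iff] at hnorm
  exact hnorm hpq

/-- Through these embeddings one and the same pair `γ`, `s` is seen at every place. -/
theorem exists_ringHom_algebraicClosure_rat (L : Type*) [Field L] [CharZero L] [IsAlgClosed L] :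
    Nonempty (AlgebraicClosure ℚ →+* L) := by
  -- Two `ℚ`-algebra structures on the closure are in scope; they agree propositionally.
  have : Algebra.IsAlgebraic ℚ (AlgebraicClosure ℚ) := by
    convert AlgebraicClosure.isAlgebraic ℚ
    · rfl
    · exact Subsingleton.elim _ _
  exact ⟨(IsAlgClosed.lift (R := ℚ) (S := AlgebraicClosure ℚ) (M := L)).toRingHom⟩

/-- The condition imposed on `(G, t)` by the `n`-th points of the two critical orbits, at the finite
places and at the infinite one. -/
def Admissible (G t : ℚ) (n : ℕ) : Prop :=
  (G.den * (G * (critCoord G t n).1 ^ 2 - t * (critCoord G t n).2 ^ 2)).den = 1 ∧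
    |G| * (critCoord G t n).1 ^ 2 + |t| * (critCoord G t n).2 ^ 2 ≤ 2 + 3 * |G|

instance (G t : ℚ) (n : ℕ) : Decidable (Admissible G t n) :=
  inferInstanceAs (Decidable (_ ∧ _))

section

variable {G t : ℚ} {γ s : AlgebraicClosure ℚ}

theorem FiniteCritOrbits.four_mul_abs_crit_cube_add_le (h : FiniteCritOrbits G t γ s) :
    4 * |G| ^ 3 + |t| ≤ 2 + 3 * |G| := by
  have e : |G| * (critCoord G t 1).1 ^ 2 + |t| * (critCoord G t 1).2 ^ 2 = 4 * |G| ^ 3 + |t| := by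
    simp only [critCoord, Function.iterate_one, coordStep]
    rw [← sub_eq_zero]
    ring_nf
    rw [← sq_abs G]
    ring
  obtain ⟨φ⟩ := exists_ringHom_algebraicClosure_rat ℂ
  have := (h.map φ).height_le 1
    (by rw [e]; have := abs_nonneg G; linarith [pow_nonneg this 3])
  rwa [e] at this

theorem FiniteCritOrbits.admissible (h : FiniteCritOrbits G t γ s)
    (n : ℕ) : Admissible G t n := by
  have hle : |t| ≤ 2 + 3 * |G| := by
    linarith [h.four_mul_abs_crit_cube_add_le, pow_nonneg (abs_nonneg G) 3]
  refine ⟨rat_den_eq_one_of_forall_norm_le_one fun p _ => ?_, ?_⟩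
  · obtain ⟨φ⟩ := exists_ringHom_algebraicClosure_rat (PadicAlgCl p)
    exact (h.map φ).norm_product_le n
  · obtain ⟨φ⟩ := exists_ringHom_algebraicClosure_rat ℂ
    by_contra! hlt
    exact hlt.not_ge ((h.map φ).height_le n (hle.trans hlt.le))

theorem FiniteCritOrbits.exists_int (h : FiniteCritOrbits G t γ s) :
    ∃ m ∈ Finset.Icc (-4 : ℤ) 4, ∃ n ∈ Finset.Icc (-80 : ℤ) 80, G = m / 4 ∧ t = n / 16 := by
  have hG : (4 * G).den = 1 := rat_den_eq_one_of_forall_norm_le_one fun p _ => by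
    obtain ⟨φ⟩ := exists_ringHom_algebraicClosure_rat (PadicAlgCl p)
    have h' := h.map φ
    have := h'.norm_four_mul_crit_le
    rw [h'.sq_crit] at this
    exact_mod_cast this
  have ht : (16 * t).den = 1 := rat_den_eq_one_of_forall_norm_le_one fun p _ => by
    obtain ⟨φ⟩ := exists_ringHom_algebraicClosure_rat (PadicAlgCl p)
    have h' := h.map φ
    have := h'.norm_sixteen_mul_const_le
    rw [h'.sq_const] at this
    exact_mod_cast this
  have hle := h.four_mul_abs_crit_cube_add_le
  have hG0 := abs_nonneg G
  have ht0 := abs_nonneg t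
  have hm : (4 * G).num = 4 * G := Rat.den_eq_one_iff _ |>.1 hG
  have hn : (16 * t).num = 16 * t := Rat.den_eq_one_iff _ |>.1 ht
  have hG54 : |G| < 5 / 4 := by
    by_contra! hc
    -- `4x³ - 3x - 2` is positive for `x ≥ 5/4`.
    nlinarith [mul_le_mul hc hc (by norm_num) hG0]
  have hmabs : |(4 * G).num| < 5 := by
    have : |((4 * G).num : ℚ)| < 5 := by rw [hm, abs_mul, abs_of_pos four_pos]; linarith
    exact_mod_cast this
  have hG1 : |G| ≤ 1 := by
    have : |((4 * G).num : ℚ)| ≤ 4 := by exact_mod_cast Int.lt_add_one_iff.1 hmabs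
    rw [hm, abs_mul, abs_of_pos four_pos] at this
    linarith
  have hnabs : |(16 * t).num| ≤ 80 := by
    have : |((16 * t).num : ℚ)| ≤ 80 := by
      rw [hn, abs_mul, abs_of_pos (by norm_num)]
      linarith [pow_nonneg hG0 3]
    exact_mod_cast this
  refine ⟨(4 * G).num, Finset.mem_Icc.2 (abs_le.1 (Int.lt_add_one_iff.1 hmabs)),
    (16 * t).num, Finset.mem_Icc.2 (abs_le.1 hnabs), ?_, ?_⟩
  · rw [hm]; ring
  · rw [hn]; ring

end

/-- The invariants `(G, t)` of the fifteen representatives. -/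
def listInvariants : Fin 15 → ℚ × ℚ :=
  ![(0, 0), (0, -1), (-1 / 2, -1 / 2), (-1 / 2, 0), (-1 / 4, -9 / 16), (1 / 2, 0), (1 / 2, 1 / 2),
    (1 / 4, 9 / 16), (-3 / 4, -3 / 16), (-1, 0), (1, 0), (3 / 4, 3 / 16), (-1 / 4, -25 / 16),
    (-1 / 2, -1), (1 / 4, -7 / 16)]

/-- Checked on each of the `9 · 161` pairs by evaluating the two conditions. -/
theorem exists_listInvariants_eq_of_admissible :
    ∀ m ∈ Finset.Icc (-4 : ℤ) 4, ∀ n ∈ Finset.Icc (-80 : ℤ) 80,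
      Admissible (m / 4) (n / 16) 1 → Admissible (m / 4) (n / 16) 2 →
        Admissible (m / 4) (n / 16) 3 → ∃ i, listInvariants i = ((m / 4, n / 16) : ℚ × ℚ) := by
  decide +kernel

theorem listInvariants_injective : Function.Injective listInvariants := by
  decide +kernel

/-! ### The fifteen representatives -/

/-- The coefficients of the fifteen representatives. -/
def listCubic : Fin 15 → Cubic ℚ :=
  ![⟨1, 0, 0, 0⟩, ⟨-1, 0, 0, 1⟩, ⟨-2, 3, 0, 1 / 2⟩, ⟨-2, 3, 0, 0⟩, ⟨-1, 3 / 2, 0, 1⟩,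
    ⟨2, -3, 0, 1⟩, ⟨2, -3, 0, 1 / 2⟩, ⟨1, -3 / 2, 0, 0⟩, ⟨-3, 9 / 2, 0, 0⟩, ⟨-4, 6, 0, -1 / 2⟩,
    ⟨4, -6, 0, 3 / 2⟩, ⟨3, -9 / 2, 0, 1⟩, ⟨-1, 3 / 2, 0, -1⟩, ⟨-1 / 4, 0, 3 / 2, 2⟩,
    ⟨-1 / 28, 0, -3 / 4, 7 / 2⟩]

theorem toPoly_listCubic (i : Fin 15) : (listCubic i).toPoly = cubicPCFList i := by
  refine Polynomial.funext fun z => ?_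
  fin_cases i <;> simp [listCubic, cubicPCFList, Cubic.toPoly] <;> ring

theorem listCubic_a_ne_zero (i : Fin 15) : (listCubic i).a ≠ 0 := by
  fin_cases i <;> simp [listCubic]

theorem listInvariants_eq (i : Fin 15) :
    listInvariants i = (critSq (listCubic i), constSq (listCubic i)) := by
  fin_cases i <;> norm_num [listCubic, listInvariants, critSq, constSq, centerShift]

theorem natDegree_cubicPCFList (i : Fin 15) : (cubicPCFList i).natDegree = 3 := by
  rw [← toPoly_listCubic]
  exact Cubic.natDegree_of_a_ne_zero (listCubic_a_ne_zero i)

/-- If the critical points of a cubic lie in a finite set that the cubic preserves, then it is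
post-critically finite. -/
theorem isPCF_toPoly_of_mapsTo {P : Cubic ℚ}
    (h : ∀ α : AlgebraicClosure ℚ, 3 * P.a * α ^ 2 + 2 * P.b * α + P.c = 0 →
      ∃ T : Set (AlgebraicClosure ℚ), T.Finite ∧ α ∈ T ∧
        ∀ z ∈ T, P.a * z ^ 3 + P.b * z ^ 2 + P.c * z + P.d ∈ T) : IsPCF P.toPoly := by
  intro α hα
  obtain ⟨T, hT, hαT, hmaps⟩ := h α (by
    rw [← hα, ← Cubic.map_toPoly]
    simp [Cubic.toPoly, Cubic.map]
    ring)
  refine hT.subset ?_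
  rintro _ ⟨n, rfl⟩
  refine Set.MapsTo.iterate (s := T) (fun z hz => ?_) n hαT
  convert hmaps z hz using 1
  simp [Cubic.toPoly]

/-- A criterion for cubics with critical points `0` and `1`, or with the double critical point `0`:
these are the first thirteen representatives. -/
theorem isPCF_toPoly_of_rational_orbit {P : Cubic ℚ} (hc : P.c = 0) (ha : P.a ≠ 0)
    (hb : P.b = 0 ∨ 2 * P.b = -3 * P.a) (T : Finset ℚ) (h0 : 0 ∈ T) (h1 : 1 ∈ T)
    (hT : ∀ z ∈ T, P.a * z ^ 3 + P.b * z ^ 2 + P.d ∈ T) : IsPCF P.toPoly := by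
  refine isPCF_toPoly_of_mapsTo fun α hα => ⟨(fun q : ℚ => (q : AlgebraicClosure ℚ)) '' T,
    T.finite_toSet.image _, ?_, ?_⟩
  · have ha' : (P.a : AlgebraicClosure ℚ) ≠ 0 := Rat.cast_ne_zero.2 ha
    rw [hc] at hα
    rcases hb with hb | hb
    · have : α = 0 := by simpa [hb, ha'] using hα
      exact ⟨0, h0, by simp [this]⟩
    · have hb' : (2 * P.b : AlgebraicClosure ℚ) = -3 * P.a := by exact_mod_cast hb
      have : (3 * P.a : AlgebraicClosure ℚ) * (α * (α - 1)) = 0 := by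
        push_cast at hα
        linear_combination hα - α * hb'
      rcases mul_eq_zero.1 ((mul_eq_zero.1 this).resolve_left (by simpa)) with h | h
      · exact ⟨0, h0, by simp [h]⟩
      · exact ⟨1, h1, by simp [sub_eq_zero.1 h]⟩
  · rintro _ ⟨q, hq, rfl⟩
    refine ⟨_, hT q hq, ?_⟩
    simp [hc]

theorem isPCF_cubicPCFList (i : Fin 15) : IsPCF (cubicPCFList i) := by
  rw [← toPoly_listCubic]
  fin_cases i
  · exact isPCF_toPoly_of_rational_orbit rfl (by decide) (by decide +kernel) {0, 1}
      (by decide +kernel) (by decide +kernel) (by decide +kernel)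
  · exact isPCF_toPoly_of_rational_orbit rfl (by decide) (by decide +kernel) {0, 1}
      (by decide +kernel) (by decide +kernel) (by decide +kernel)
  · exact isPCF_toPoly_of_rational_orbit rfl (by decide) (by decide +kernel) {0, 1 / 2, 1, 3 / 2}
      (by decide +kernel) (by decide +kernel) (by decide +kernel)
  · exact isPCF_toPoly_of_rational_orbit rfl (by decide) (by decide +kernel) {0, 1}
      (by decide +kernel) (by decide +kernel) (by decide +kernel)
  · exact isPCF_toPoly_of_rational_orbit rfl (by decide) (by decide +kernel) {0, 1, 3 / 2}
      (by decide +kernel) (by decide +kernel) (by decide +kernel)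
  · exact isPCF_toPoly_of_rational_orbit rfl (by decide) (by decide +kernel) {0, 1}
      (by decide +kernel) (by decide +kernel) (by decide +kernel)
  · exact isPCF_toPoly_of_rational_orbit rfl (by decide) (by decide +kernel) {0, 1 / 2, 1, -1 / 2}
      (by decide +kernel) (by decide +kernel) (by decide +kernel)
  · exact isPCF_toPoly_of_rational_orbit rfl (by decide) (by decide +kernel) {0, 1, -1 / 2}
      (by decide +kernel) (by decide +kernel) (by decide +kernel)
  · exact isPCF_toPoly_of_rational_orbit rfl (by decide) (by decide +kernel) {0, 1, 3 / 2}
      (by decide +kernel) (by decide +kernel) (by decide +kernel)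
  · exact isPCF_toPoly_of_rational_orbit rfl (by decide) (by decide +kernel) {0, -1 / 2, 3 / 2, 1}
      (by decide +kernel) (by decide +kernel) (by decide +kernel)
  · exact isPCF_toPoly_of_rational_orbit rfl (by decide) (by decide +kernel) {0, 3 / 2, 1, -1 / 2}
      (by decide +kernel) (by decide +kernel) (by decide +kernel)
  · exact isPCF_toPoly_of_rational_orbit rfl (by decide) (by decide +kernel) {0, 1, -1 / 2}
      (by decide +kernel) (by decide +kernel) (by decide +kernel)
  · exact isPCF_toPoly_of_rational_orbit rfl (by decide) (by decide +kernel) {0, -1, 3 / 2, 1, -1 / 2}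
      (by decide +kernel) (by decide +kernel) (by decide +kernel)
  · refine isPCF_toPoly_of_mapsTo fun α hα => ?_
    have hα2 : α ^ 2 = 2 := by
      simp [listCubic] at hα
      linear_combination -4 / 3 * hα
    -- The critical orbit is `α ↦ α + 2 ↦ -2α ↦ α + 2`.
    refine ⟨{α, α + 2, -2 * α}, by simp, by simp, ?_⟩
    rintro z (rfl | rfl | rfl)
    · right; left
      simp [listCubic]
      linear_combination -1 / 4 * z * hα2
    · right; right
      simp [listCubic]
      linear_combination (-1 / 4 * α - 3 / 2) * hα2
    · right; left
      simp [listCubic]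
      linear_combination 2 * α * hα2
  · refine isPCF_toPoly_of_mapsTo fun α hα => ?_
    have hα2 : α ^ 2 = -7 := by
      simp [listCubic] at hα
      linear_combination -28 / 3 * hα
    -- The critical orbit is `α ↦ (7 - α) / 2 ↦ α`.
    refine ⟨{α, (7 - α) / 2}, by simp, by simp, ?_⟩
    rintro z (rfl | rfl)
    · right
      simp [listCubic]
      linear_combination -1 / 28 * z * hα2
    · left
      simp [listCubic]
      linear_combination (α - 21) / 224 * hα2

theorem exists_conjugate_cubicPCFList {f : ℚ[X]} (hf : f.natDegree = 3) (h : IsPCF f) :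
    ∃ i, Conjugate f (cubicPCFList i) := by
  obtain ⟨P, hP, rfl⟩ := exists_cubic_toPoly_eq hf
  obtain ⟨γ, s, hγ, hs, hfin⟩ := h.exists_centeredMap hP
  have hcrit : FiniteCritOrbits (critSq P) (constSq P) γ s := ⟨hγ, hs, hfin⟩
  obtain ⟨m, hm, n, hn, hG, ht⟩ := hcrit.exists_int
  have hadm := hcrit.admissible
  rw [hG, ht] at hadm
  obtain ⟨i, hi⟩ := exists_listInvariants_eq_of_admissible m hm n hn (hadm 1) (hadm 2) (hadm 3)
  refine ⟨i, ?_⟩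
  rw [← toPoly_listCubic, conjugate_toPoly_iff hP (listCubic_a_ne_zero i), hG, ht]
  rw [listInvariants_eq, Prod.mk.injEq] at hi
  exact ⟨hi.1.symm, hi.2.symm⟩

theorem eq_of_conjugate_cubicPCFList {i j : Fin 15}
    (h : Conjugate (cubicPCFList i) (cubicPCFList j)) : i = j := by
  rw [← toPoly_listCubic, ← toPoly_listCubic,
    conjugate_toPoly_iff (listCubic_a_ne_zero i) (listCubic_a_ne_zero j)] at h
  apply listInvariants_injective
  rw [listInvariants_eq, listInvariants_eq, h.1, h.2]

theorem ncard_cubicPCFClasses : cubicPCFClasses.ncard = 15 := by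
  have hrange : cubicPCFClasses =
      Set.range fun i => Quotient.mk (conjSetoid ℚ) (cubicPCFList i) := by
    ext c
    constructor
    · rintro ⟨f, hf, h, rfl⟩
      obtain ⟨i, hi⟩ := exists_conjugate_cubicPCFList hf h
      exact ⟨i, (Quotient.sound hi).symm⟩
    · rintro ⟨i, rfl⟩
      exact ⟨_, natDegree_cubicPCFList i, isPCF_cubicPCFList i, rfl⟩
  have hinj : Function.Injective fun i => Quotient.mk (conjSetoid ℚ) (cubicPCFList i) :=
    fun i j hij => eq_of_conjugate_cubicPCFList (Quotient.exact hij)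
  rw [hrange, ← Set.image_univ, Set.ncard_image_of_injective _ hinj, Set.ncard_univ,
    Nat.card_eq_fintype_card, Fintype.card_fin]

end CubicPCF

theorem mainTheorem1 :
    CubicPCF.cubicPCFClasses.ncard = 15 ∧
    (∀ i : Fin 15, (CubicPCF.cubicPCFList i).natDegree = 3 ∧
      CubicPCF.IsPCF (CubicPCF.cubicPCFList i)) ∧
    (∀ i j : Fin 15, i ≠ j →
      ¬ CubicPCF.Conjugate (CubicPCF.cubicPCFList i) (CubicPCF.cubicPCFList j)) ∧
    (∀ f : ℚ[X], f.natDegree = 3 → CubicPCF.IsPCF f →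
      ∃ i : Fin 15, CubicPCF.Conjugate f (CubicPCF.cubicPCFList i)) :=
  ⟨CubicPCF.ncard_cubicPCFClasses,
    fun i => ⟨CubicPCF.natDegree_cubicPCFList i, CubicPCF.isPCF_cubicPCFList i⟩,
    fun _ _ hij h => hij (CubicPCF.eq_of_conjugate_cubicPCFList h),
    fun _ hf h => CubicPCF.exists_conjugate_cubicPCFList hf h⟩
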